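/- Let $G$ be a second-countable, locally compact, Hausdorff group acting continuously on a second-countable, locally compact, Hausdorff space $X$. For $x\in X$ let $S_x=\{s\in G: s\cdot x=x\}$, let $q_x:G\to G/S_x$ be the quotient map and let $\phi_x:G\to X$, $\phi_x(s)=s\cdot x$. Let $\Sigma$ be the set of closed subgroups of $G$ with the Fell topology: a basis is given by the sets $\{H\in\Sigma: H\cap C=\emptyset,\ H\cap A\ne\emptyset\text{ for all }A\in F\}$ with $C\subset G$ compact and $F$ a finite family of non-empty open subsets of $G$. Fix a left Haar measure $\mu$ on $G$ and $f_0\in C_c(G)$ with $f_0(e)=1$ and $0\le f_0\le 1$. For $H\in\Sigma$ let $\alpha_H$ be the left Haar measure on $H$ with $\int_H f_0\,d\alpha_H=1$. If $H$ is moreover normal in $G$, let $\lambda_H$ be the left Haar measure on $G/H$ with $$\int_G f(s)\,d\mu(s)=\int_{G/H}\int_H f(st)\,d\alpha_H(t)\,d\lambda_H(sH)\qquad\text{for all }f\in C_c(G),$$ and let $\nu_H$ be the right Haar measure $\nu_H(E)=\lambda_H(E^{-1})$ on $G/H$ (so $\nu_H=\lambda_H$ if $G/H$ is unimodular). Write $\nu_x$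 for $\nu_{S_x}$. A sequence $(x_n)$ in $X$ converges $k$-times in $X/G$ to $z\in X$ if there are $k$ sequences $(t_n^{(1)})_n,\dots,(t_n^{(k)})_n$ in $G$ such that $t_n^{(i)}\cdot x_n\to z$ as $n\to\infty$ for $1\le i\le k$ and, for $1\le i<j\le k$ and every compact $K\subset G$, the set $t_n^{(j)}(t_n^{(i)})^{-1}S_{x_n}$ is disjoint from $K$ for all sufficiently large $n$. **Proposition.** Let $z\in X$ be such that $G\cdot z$ is locally closed in $X$ and $S_z$ is compact. Let $(x_n)_{n\ge1}$ be a sequence in $X$ such that $S_{x_n}\to S_z$ in $\Sigma$, such that $S_z$ and all $S_{x_n}$ are normal in $G$, and such that $G\cdot z$ is the unique limit of $(G\cdot x_n)_n$ in the quotient space $X/G$. Let $k\ge 1$ be an integer, and suppose that there is a decreasing sequence $(W_m)_{m\ge1}$ of compact neighbourhoods of $z$ that is a base of neighbourhoods of $z$ such that, for each $m$, $$\liminf_n\nu_{x_n}\big(q_{x_n}(\phi_{x_n}^{-1}(W_m))\big)>(k-1)\,\nu_z\big(q_z(\phi_z^{-1}(W_m))\big)$$ (values in $[0,\infty]$, with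 $0\cdot\infty=0$). Then $(x_n)$ converges $k$-times in $X/G$ to $z$. -/

import Mathlib

open Filter Topology MeasureTheory
open scoped Pointwise ENNReal

namespace OrbitConvergence

section Measures

variable {G : Type*} [Group G] [TopologicalSpace G]

/-- The auxiliary function that normalizes Haar measure on all closed subgroups simultaneously:
`f ∈ C_c(G)` with `f(e) = 1` and `0 ≤ f ≤ 1`. -/
structure Normalizer (G : Type*) [Group G] [TopologicalSpace G] where
  toFun : G → ℝ
  continuous' : Continuous toFun
  hasCompactSupport' : HasCompactSupport toFun
  map_one' : toFun 1 = 1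
  nonneg' : ∀ s, 0 ≤ toFun s
  le_one' : ∀ s, toFun s ≤ 1

instance : CoeFun (Normalizer G) (fun _ => G → ℝ) := ⟨Normalizer.toFun⟩

/-- A basic open set of the Fell topology: the closed subgroups that miss the set `C` and meet
every member of the family `F`. -/
def fellBasic (C : Set G) (F : Set (Set G)) : Set (ClosedSubgroup G) :=
  {H | C ∩ (H : Set G) = ∅ ∧ ∀ A ∈ F, ((H : Set G) ∩ A).Nonempty}

/-- The Fell topology on the set `Σ` of closed subgroups of `G`, generated by the sets
`U(C, F)` with `C` compact and `F` a finite family of non-empty open sets. -/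
instance fellTopology : TopologicalSpace (ClosedSubgroup G) :=
  TopologicalSpace.generateFrom
    {U | ∃ (C : Set G) (F : Set (Set G)), IsCompact C ∧ F.Finite ∧
      (∀ A ∈ F, IsOpen A ∧ A.Nonempty) ∧ U = fellBasic C F}

theorem locallyCompactSpace_of_isClosed [LocallyCompactSpace G] (H : Subgroup G) [hH : IsClosed (H : Set G)] :
    LocallyCompactSpace H :=
  hH.isClosedEmbedding_subtypeVal.locallyCompactSpace

variable [MeasurableSpace G] [BorelSpace G]

theorem integral_normalizer_pos (f₀ : Normalizer G) (H : Subgroup G) [hH : IsClosed (H : Set G)]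
    (m : Measure H) [m.IsHaarMeasure] : 0 < ∫ t : H, f₀ t ∂m := by
  have hc : Continuous (fun t : H => f₀ t) := f₀.continuous'.comp continuous_subtype_val
  refine hc.integral_pos_of_hasCompactSupport_nonneg_nonzero
    (f₀.hasCompactSupport'.comp_isClosedEmbedding hH.isClosedEmbedding_subtypeVal)
    (fun t => f₀.nonneg' t) (x := 1) ?_
  simp [f₀.map_one']

variable [IsTopologicalGroup G]

/-- The function `sH ↦ ∫_H f(st) dα(t)` on `G/H`; see `cosetIntegral_mk`. -/
noncomputable def cosetIntegral {H : Subgroup G} (α : Measure H) (f : G → ℝ) (q : G ⧸ H) : ℝ :=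
  ∫ t : H, f (q.out * t) ∂α

theorem cosetIntegral_mk {H : Subgroup G} (α : Measure H) [α.IsMulLeftInvariant] (f : G → ℝ)
    (s : G) : cosetIntegral α f (QuotientGroup.mk s : G ⧸ H) = ∫ t : H, f (s * t) ∂α := by
  obtain ⟨h, hh⟩ := QuotientGroup.mk_out_eq_mul H s
  rw [cosetIntegral, hh, ← integral_mul_left_eq_self (fun t : H => f (s * t)) h]
  simp [mul_assoc]

variable [LocallyCompactSpace G]

/-- Left Haar measure `α_H` on the closed subgroup `H`, normalized by `∫_H f₀ dα_H = 1`. -/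
noncomputable def subgroupHaar (f₀ : Normalizer G) (H : Subgroup G) [IsClosed (H : Set G)] :
    Measure H :=
  have := locallyCompactSpace_of_isClosed H
  (ENNReal.ofReal (∫ t : H, f₀ t ∂(Measure.haar : Measure H)))⁻¹ • (Measure.haar : Measure H)

instance isHaarMeasure_subgroupHaar (f₀ : Normalizer G) (H : Subgroup G)
    [IsClosed (H : Set G)] : (subgroupHaar f₀ H).IsHaarMeasure := by
  have := locallyCompactSpace_of_isClosed H
  refine Measure.IsHaarMeasure.smul _ (by simp) ?_
  simpa using integral_normalizer_pos f₀ H Measure.haar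

theorem integral_subgroupHaar (f₀ : Normalizer G) (H : Subgroup G) [IsClosed (H : Set G)] :
    ∫ t : H, f₀ t ∂(subgroupHaar f₀ H) = 1 := by
  have := locallyCompactSpace_of_isClosed H
  have h := integral_normalizer_pos f₀ H (Measure.haar : Measure H)
  rw [subgroupHaar, integral_smul_measure, ENNReal.toReal_inv, ENNReal.toReal_ofReal h.le,
    smul_eq_mul, inv_mul_cancel₀ h.ne']

/-- `ν` is the right-invariant Haar measure on `G/H` attached to the left Haar measures `μ` on `G`
and `α` on `H`: its image `ν.inv` under inversion, which is a left Haar measure, satisfies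
`∫_G f dμ = ∫_{G/H} ∫_H f(st) dα(t) dν.inv(sH)` for all `f ∈ C_c(G)`.
If `G/H` is unimodular, then `ν.inv = ν`, and `ν` itself satisfies this formula; if `G/H` is not
unimodular, no right-invariant measure does
(see `isQuotientMeasure_of_rightInvariant_of_weil`). -/
structure IsQuotientMeasure (μ : Measure G) {H : Subgroup G} [H.Normal] (α : Measure H)
    (ν : Measure (G ⧸ H)) : Prop where
  rightInvariant : ν.IsMulRightInvariant
  finiteOnCompacts : IsFiniteMeasureOnCompacts ν
  weil : ∀ f : G → ℝ, Continuous f → HasCompactSupport f →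
    ∫ s, f s ∂μ = ∫ q, cosetIntegral α f q ∂ν.inv

variable [T2Space G] [SecondCountableTopology G]

theorem polishSpace_of_locallyCompact_group (G : Type*) [Group G] [TopologicalSpace G]
    [IsTopologicalGroup G] [LocallyCompactSpace G] [T2Space G] [SecondCountableTopology G] :
    PolishSpace G := by
  let _ : UniformSpace G := IsTopologicalGroup.rightUniformSpace G
  have : IsRightUniformGroup G := ⟨rfl⟩
  have : CompleteSpace G := IsRightUniformGroup.completeSpace_of_weaklyLocallyCompactSpace
  have : (uniformity G).IsCountablyGenerated := by
    rw [uniformity_eq_comap_nhds_one]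
    infer_instance
  infer_instance

instance borelSpace_quotient (H : Subgroup G) [H.Normal] [IsClosed (H : Set G)] :
    BorelSpace (G ⧸ H) :=
  have := polishSpace_of_locallyCompact_group G
  inferInstance

theorem exists_isQuotientMeasure (μ : Measure G) [μ.IsHaarMeasure] {H : Subgroup G} [H.Normal]
    [hH : IsClosed (H : Set G)] (α : Measure H) [α.IsHaarMeasure] :
    ∃ ν : Measure (G ⧸ H), IsQuotientMeasure μ α ν := by
  have S := TopologicalGroup.IsSES.ofClosedSubgroup H hH
  let lam : Measure (G ⧸ H) := Measure.haar
  let m : Measure G := S.inducedMeasure α lam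
  have hm : m.IsHaarMeasure := S.isHaarMeasure_inducedMeasure α lam
  have key : ∀ f : G → ℝ, Continuous f → HasCompactSupport f →
      ∫ s, f s ∂m = ∫ q, cosetIntegral α f q ∂lam := by
    intro f hf hc
    have := S.integral_inducedMeasure α lam ⟨⟨f, hf⟩, hc⟩
    rw [TopologicalGroup.IsSES.integrate_apply] at this
    refine this.trans (integral_congr_ae (.of_forall fun q => ?_))
    obtain ⟨s, rfl⟩ := QuotientGroup.mk_surjective q
    rw [cosetIntegral_mk]
    exact S.pushforward_apply_apply α _ s
  have hμ : μ = Measure.haarScalarFactor μ m • m := Measure.isMulLeftInvariant_eq_smul μ m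
  set c := Measure.haarScalarFactor μ m
  have hr : (c • lam).inv.IsMulRightInvariant := inferInstance
  refine ⟨(c • lam).inv, hr, inferInstance, fun f hf hc => ?_⟩
  rw [Measure.inv_inv, hμ, integral_smul_nnreal_measure, integral_smul_nnreal_measure,
    key f hf hc]

/-- The measure `ν_H` on `G/H`, for the choice `α_H = subgroupHaar f₀ H`. -/
noncomputable def quotientHaar (μ : Measure G) [μ.IsHaarMeasure] (f₀ : Normalizer G)
    (H : Subgroup G) [H.Normal] [IsClosed (H : Set G)] : Measure (G ⧸ H) :=
  (exists_isQuotientMeasure μ (subgroupHaar f₀ H)).choose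

theorem isQuotientMeasure_quotientHaar (μ : Measure G) [μ.IsHaarMeasure] (f₀ : Normalizer G)
    (H : Subgroup G) [H.Normal] [IsClosed (H : Set G)] :
    IsQuotientMeasure μ (subgroupHaar f₀ H) (quotientHaar μ f₀ H) :=
  (exists_isQuotientMeasure μ (subgroupHaar f₀ H)).choose_spec

theorem eq_of_weil (μ : Measure G) [μ.IsHaarMeasure] {H : Subgroup G} [H.Normal]
    [hH : IsClosed (H : Set G)] (α : Measure H) (lam lam' : Measure (G ⧸ H))
    [lam.IsMulLeftInvariant] [IsFiniteMeasureOnCompacts lam]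
    [lam'.IsMulLeftInvariant] [IsFiniteMeasureOnCompacts lam']
    (h : ∀ f : G → ℝ, Continuous f → HasCompactSupport f →
      ∫ s, f s ∂μ = ∫ q, cosetIntegral α f q ∂lam)
    (h' : ∀ f : G → ℝ, Continuous f → HasCompactSupport f →
      ∫ s, f s ∂μ = ∫ q, cosetIntegral α f q ∂lam') : lam = lam' := by
  obtain ⟨⟨g, gc⟩, g_comp, g_nonneg, g_one⟩ := exists_continuous_nonneg_pos (1 : G)
  have hpos : 0 < ∫ x, g x ∂μ :=
    gc.integral_pos_of_hasCompactSupport_nonneg_nonzero g_comp g_nonneg g_one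
  have e := Measure.isMulLeftInvariant_eq_smul lam Measure.haar
  have e' := Measure.isMulLeftInvariant_eq_smul lam' Measure.haar
  have h1 := h g gc g_comp
  have h2 := h' g gc g_comp
  rw [e, integral_smul_nnreal_measure, NNReal.smul_def, smul_eq_mul] at h1
  rw [e', integral_smul_nnreal_measure, NNReal.smul_def, smul_eq_mul] at h2
  rw [e, e']
  congr 1
  have h3 := h1.symm.trans h2
  refine NNReal.coe_injective (mul_right_cancel₀ ?_ h3)
  intro h0
  rw [h0, mul_zero] at h1
  exact hpos.ne' h1

theorem IsQuotientMeasure.unique {μ : Measure G} [μ.IsHaarMeasure] {H : Subgroup G} [H.Normal]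
    [hH : IsClosed (H : Set G)] {α : Measure H} {ν ν' : Measure (G ⧸ H)}
    (h : IsQuotientMeasure μ α ν) (h' : IsQuotientMeasure μ α ν') : ν = ν' := by
  have := h.rightInvariant
  have := h.finiteOnCompacts
  have := h'.rightInvariant
  have := h'.finiteOnCompacts
  have := eq_of_weil μ α ν.inv ν'.inv h.weil h'.weil
  rw [← ν.inv_inv, this, ν'.inv_inv]

/-- A right-invariant measure that itself satisfies the quotient integral formula is inversion
invariant, hence is the measure of `IsQuotientMeasure`. -/
theorem isQuotientMeasure_of_rightInvariant_of_weil {μ : Measure G} [μ.IsHaarMeasure]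
    {H : Subgroup G} [H.Normal] [hH : IsClosed (H : Set G)] {α : Measure H} [α.IsHaarMeasure]
    {ν : Measure (G ⧸ H)} [ν.IsMulRightInvariant] [IsFiniteMeasureOnCompacts ν]
    (h : ∀ f : G → ℝ, Continuous f → HasCompactSupport f →
      ∫ s, f s ∂μ = ∫ q, cosetIntegral α f q ∂ν) :
    IsQuotientMeasure μ α ν ∧ ν.inv = ν := by
  obtain ⟨⟨g, gc⟩, g_comp, g_nonneg, g_one⟩ := exists_continuous_nonneg_pos (1 : G)
  have hpos : 0 < ∫ x, g x ∂μ :=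
    gc.integral_pos_of_hasCompactSupport_nonneg_nonzero g_comp g_nonneg g_one
  have hleft : ν.IsMulLeftInvariant := by
    refine ⟨fun a => ?_⟩
    obtain ⟨r, rfl⟩ := QuotientGroup.mk_surjective a
    set ν' : Measure (G ⧸ H) := ν.map ((r : G ⧸ H) * ·) with hν'
    have : ν'.IsMulRightInvariant := by
      refine ⟨fun b => ?_⟩
      rw [hν', Measure.map_map (by fun_prop) (by fun_prop)]
      conv_rhs => rw [← map_mul_right_eq_self ν b]
      rw [Measure.map_map (by fun_prop) (by fun_prop)]
      simp [Function.comp_def, mul_assoc]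
    have : IsFiniteMeasureOnCompacts ν' :=
      Measure.IsFiniteMeasureOnCompacts.map ν (Homeomorph.mulLeft (r : G ⧸ H))
    suffices ν'.inv = ν.inv by rw [← ν'.inv_inv, this, ν.inv_inv]
    have e := Measure.isMulLeftInvariant_eq_smul ν'.inv Measure.haar
    have e' := Measure.isMulLeftInvariant_eq_smul ν.inv Measure.haar
    have hint : ∀ m : Measure (G ⧸ H), ∫ q, cosetIntegral α g q⁻¹ ∂m.inv =
        ∫ q, cosetIntegral α g q ∂m := by
      intro m
      rw [Measure.inv_def]
      refine ((MeasurableEquiv.inv (G ⧸ H)).measurableEmbedding.integral_map _).trans ?_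
      simp
    have h1 := hint ν'
    have h2 := hint ν
    have h3 : ∫ q, cosetIntegral α g q ∂ν' = ∫ x, g x ∂μ := by
      rw [hν']
      refine ((MeasurableEquiv.mulLeft (r : G ⧸ H)).measurableEmbedding.integral_map _).trans ?_
      rw [← integral_mul_left_eq_self g r, h (fun s => g (r * s)) (by fun_prop)
        (g_comp.comp_homeomorph (Homeomorph.mulLeft r))]
      refine integral_congr_ae (.of_forall fun q => ?_)
      obtain ⟨s, rfl⟩ := QuotientGroup.mk_surjective q
      have : MeasurableEquiv.mulLeft (r : G ⧸ H) (s : G ⧸ H) = ((r * s : G) : G ⧸ H) := rfl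
      simp only [this, cosetIntegral_mk, mul_assoc]
    rw [h3, e, integral_smul_nnreal_measure, NNReal.smul_def, smul_eq_mul] at h1
    rw [← h g gc g_comp, e', integral_smul_nnreal_measure, NNReal.smul_def, smul_eq_mul] at h2
    rw [e, e']
    congr 1
    refine NNReal.coe_injective (mul_right_cancel₀ ?_ (h1.trans h2.symm))
    intro h0
    rw [h0, mul_zero] at h1
    exact hpos.ne h1
  have hinv : ν.inv = ν := by
    obtain ⟨c, e⟩ : ∃ c : NNReal, ν.inv = c • Measure.haar :=
      ⟨_, Measure.isMulLeftInvariant_eq_smul ν.inv Measure.haar⟩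
    obtain ⟨d, e'⟩ : ∃ d : NNReal, ν = d • Measure.haar :=
      ⟨_, Measure.isMulLeftInvariant_eq_smul ν Measure.haar⟩
    obtain ⟨K, hK, hK1⟩ := exists_compact_mem_nhds (1 : G ⧸ H)
    have hKc : IsCompact (K ∪ K⁻¹) := hK.union hK.inv
    have hs : (K ∪ K⁻¹)⁻¹ = K ∪ K⁻¹ := by rw [Set.union_inv, inv_inv, Set.union_comm]
    have hm : ν.inv (K ∪ K⁻¹) = ν (K ∪ K⁻¹) := by rw [Measure.inv_apply, hs]
    rw [e] at hm
    nth_rewrite 1 [e'] at hm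
    rw [Measure.smul_apply, Measure.smul_apply] at hm
    have h0 : (Measure.haar : Measure (G ⧸ H)) (K ∪ K⁻¹) ≠ 0 :=
      (Measure.measure_pos_of_mem_nhds _ (Filter.mem_of_superset hK1 Set.subset_union_left)).ne'
    refine e.trans (Eq.trans ?_ e'.symm)
    congr 1
    simp only [ENNReal.smul_def, smul_eq_mul] at hm
    exact_mod_cast (ENNReal.mul_left_inj h0 hKc.measure_ne_top).1 hm
  exact ⟨⟨inferInstance, inferInstance, fun f hf hc => by rw [hinv]; exact h f hf hc⟩, hinv⟩

end Measures

section Action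

variable {G X : Type*} [Group G] [TopologicalSpace G] [TopologicalSpace X] [MulAction G X]

instance isClosed_stabilizer [T1Space X] [ContinuousSMul G X] (x : X) :
    IsClosed (MulAction.stabilizer G x : Set G) :=
  isClosed_singleton.preimage (continuous_id.smul continuous_const : Continuous fun s : G => s • x)

/-- The stability subgroup `S_x` as a point of the space of closed subgroups of `G`. -/
def closedStabilizer (G : Type*) {X : Type*} [Group G] [TopologicalSpace G] [TopologicalSpace X]
    [MulAction G X] [T1Space X] [ContinuousSMul G X] (x : X) : ClosedSubgroup G where
  toSubgroup := MulAction.stabilizer G x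
  isClosed' := isClosed_stabilizer x

/-- The sequence `x` converges `k`-times in `X/G` to `z`. -/
def ConvergesKTimes (G : Type*) {X : Type*} [Group G] [TopologicalSpace G] [TopologicalSpace X]
    [MulAction G X] (k : ℕ) (x : ℕ → X) (z : X) : Prop :=
  ∃ t : Fin k → ℕ → G,
    (∀ i, Tendsto (fun n => t i n • x n) atTop (𝓝 z)) ∧
    ∀ i j, i < j → ∀ K : Set G, IsCompact K → ∀ᶠ n in atTop,
      Disjoint ((t j n * (t i n)⁻¹) • (MulAction.stabilizer G (x n) : Set G)) K

variable [IsTopologicalGroup G] [LocallyCompactSpace G] [T2Space G] [SecondCountableTopology G]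
  [MeasurableSpace G] [BorelSpace G] [T1Space X] [ContinuousSMul G X]

/-- `ν_x(q_x(φ_x⁻¹(W)))`, where `φ_x(s) = s • x`, `q_x : G → G/S_x` is the quotient map and
`ν_x` is the Haar measure on `G/S_x`. -/
noncomputable def orbitMass (μ : Measure G) [μ.IsHaarMeasure] (f₀ : Normalizer G) (x : X)
    [(MulAction.stabilizer G x).Normal] (W : Set X) : ℝ≥0∞ :=
  quotientHaar μ f₀ (MulAction.stabilizer G x)
    ((QuotientGroup.mk : G → G ⧸ MulAction.stabilizer G x) '' ((fun s : G => s • x) ⁻¹' W))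

end Action

end OrbitConvergence

/-! By a diagonal argument it suffices that, for fixed `m` and compact `K`, eventually the orbit of
`x n` has `k` points in `W m` that are pairwise `K`-separated. This is tested along an ultrafilter
`l` finer than `atTop`, where sequences in compact sets converge, and there are two cases.

If limits along `l` of points of the orbits, lying off `G • z`, accumulate at `z`, then `k` such
limits can be chosen near `z`, none in the `K`-translates of the earlier ones; points of the orbits
converging to them are eventually `K`-separated (`eventually_exists_separated_of_accumulation`).

Otherwise all limits in some small `W m'` lie on `G • z`. Seen from any of its points in `W m'`, the
part of the orbit of `x n` in `W m'` reached through `K` then has mass at most `c`, for any `c`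
above the mass of `G • z` in `W m'` (`eventually_quotientHaar_image_le`). Fewer than `k` such parts
cannot exhaust a mass exceeding `(k - 1) * c`, so separated points can be chosen greedily
(`exists_separated_of_lt_orbitMass`).

The analytic input is upper semicontinuity of the quotient measures on compact sets
(`exists_isOpen_eventually_quotientHaar_image_le`). Through Weil's formula it follows from lower
semicontinuity of the normalized Haar measures of subgroups converging to a compact one
(`eventually_lt_subgroupHaar`). -/

namespace OrbitConvergence

/-! ### Haar measures of subgroups near a compact subgroup -/

section Haar

variable {G : Type*} [Group G] [TopologicalSpace G] [IsTopologicalGroup G]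

/-- A compactly supported continuous function varies little under small left translations. -/
theorem exists_nhds_one_abs_sub_lt [LocallyCompactSpace G] {f : G → ℝ} (hf : Continuous f)
    (hc : HasCompactSupport f) {ε : ℝ} (hε : 0 < ε) :
    ∃ N ∈ 𝓝 (1 : G), ∀ u ∈ N, ∀ s, |f (u * s) - f s| < ε := by
  let _ : UniformSpace G := IsTopologicalGroup.rightUniformSpace G
  have : IsRightUniformGroup G := ⟨rfl⟩
  have h := hc.uniformContinuous_of_continuous hf
  have h1 := h (Metric.dist_mem_uniformity hε)
  rw [Filter.mem_map, uniformity_eq_comap_nhds_one, Filter.mem_comap] at h1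
  obtain ⟨N, hN, hsub⟩ := h1
  refine ⟨N, hN, fun u hu s => ?_⟩
  have : (s, u * s) ∈ (fun p : G × G => (f p.1, f p.2)) ⁻¹' {p | dist p.1 p.2 < ε} := by
    apply hsub
    simpa using hu
  simpa [Real.dist_eq, abs_sub_comm] using this

/-- If every point of the compact set `C` is a limit of points of `S i`, then `C` is contained
uniformly in small translates of `S i`. -/
theorem eventually_forall_exists_mul_inv_mem {ι : Type*} {l : Filter ι} {S : ι → Set G}
    {C : Set G} (hC : IsCompact C)
    (hS : ∀ A : Set G, IsOpen A → (C ∩ A).Nonempty → ∀ᶠ i in l, (S i ∩ A).Nonempty)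
    {N : Set G} (hN : N ∈ 𝓝 (1 : G)) :
    ∀ᶠ i in l, ∀ h ∈ C, ∃ h' ∈ S i, h' * h⁻¹ ∈ N := by
  refine hC.induction_on (p := fun T => ∀ᶠ i in l, ∀ h ∈ T, ∃ h' ∈ S i, h' * h⁻¹ ∈ N)
    (by simp) (fun s t hst ht => ht.mono fun i hi h hh => hi h (hst hh))
    (fun s t hs ht => by
      filter_upwards [hs, ht] with i h1 h2 h hh
      exact hh.elim (h1 h) (h2 h)) fun h₀ hh₀ => ?_
  have hcont : Tendsto (fun p : G × G => p.1 * p.2⁻¹) (𝓝 h₀ ×ˢ 𝓝 h₀) (𝓝 1) := by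
    have : Continuous (fun p : G × G => p.1 * p.2⁻¹) := by fun_prop
    simpa [nhds_prod_eq] using this.tendsto (h₀, h₀)
  obtain ⟨A, hA, hAN⟩ := mem_prod_same_iff.1 (hcont hN)
  obtain ⟨B, hBA, hB, hhB⟩ := mem_nhds_iff.1 hA
  refine ⟨B, mem_nhdsWithin_of_mem_nhds (hB.mem_nhds hhB), ?_⟩
  filter_upwards [hS B hB ⟨h₀, hh₀, hhB⟩] with i ⟨h', hh', hh'B⟩ h hh
  exact ⟨h', hh', hAN (Set.mk_mem_prod (hBA hh'B) (hBA hh))⟩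

variable [MeasurableSpace G] [BorelSpace G]

/-- Conjugation is a continuous surjective endomorphism, so it preserves the Haar measure of a
compact group; a right translation is a left translation combined with a conjugation. -/
theorem lintegral_mul_right_eq_self_of_compactSpace [CompactSpace G] [T2Space G]
    (μ : Measure G) [μ.IsHaarMeasure] (f : G → ℝ≥0∞) (g : G) :
    ∫⁻ x, f (x * g) ∂μ = ∫⁻ x, f x ∂μ := by
  have hc : Continuous (MulAut.conj g⁻¹ : G →* G) := by
    have : ⇑((MulAut.conj g⁻¹ : MulAut G) : G →* G) = fun x => g⁻¹ * x * g := by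
      ext x; simp
    rw [this]
    fun_prop
  have hp : MeasurePreserving (MulAut.conj g⁻¹ : G →* G) μ μ :=
    MonoidHom.measurePreserving hc (MulAut.conj g⁻¹).surjective rfl
  have he : MeasurableEmbedding (MulAut.conj g⁻¹ : G →* G) := by
    have : ⇑((MulAut.conj g⁻¹ : MulAut G) : G →* G)
        = (Homeomorph.mulLeft g⁻¹).trans (Homeomorph.mulRight g) := by
      ext x; simp
    rw [this]
    exact Homeomorph.measurableEmbedding _
  rw [← lintegral_mul_left_eq_self f g, ← hp.lintegral_comp_emb he (fun x => f (g * x))]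
  simp [mul_assoc]

variable [LocallyCompactSpace G] [T2Space G] [SecondCountableTopology G]

/-- Lower semicontinuity, on open sets around a compact limit subgroup, of the normalized Haar
measures. -/
theorem eventually_lt_subgroupHaar (f₀ : Normalizer G) {ι : Type*} {l : Filter ι}
    (H' : ι → Subgroup G) [hH' : ∀ i, IsClosed (H' i : Set G)] (H : Subgroup G)
    [hH : IsClosed (H : Set G)] (hcpt : IsCompact (H : Set G))
    (hmiss : ∀ C : Set G, IsCompact C → Disjoint C H → ∀ᶠ i in l, Disjoint C (H' i))
    (hmeet : ∀ A : Set G, IsOpen A → ((H : Set G) ∩ A).Nonempty →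
      ∀ᶠ i in l, ((H' i : Set G) ∩ A).Nonempty)
    {D : Set G} (hD : IsOpen D) (hHD : (H : Set G) ⊆ D) {b : ℝ≥0∞}
    (hb : b < subgroupHaar f₀ H Set.univ) :
    ∀ᶠ i in l, b < subgroupHaar f₀ (H' i) (Subtype.val ⁻¹' D) := by
  have : CompactSpace H := isCompact_iff_compactSpace.1 hcpt
  set α := subgroupHaar f₀ H with hα
  -- The factor in front of `b` is the one produced by the final Fubini estimate. In the choice of
  -- `ε`, the `B + 1` makes the inequality strict and covers `B = 0`.
  obtain ⟨ε, hε, hεb⟩ : ∃ ε : ℝ, 0 < ε ∧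
      (1 + ENNReal.ofReal ε + ENNReal.ofReal ε * α Set.univ) * b < α Set.univ := by
    have ha : α Set.univ ≠ ∞ := measure_ne_top _ _
    lift α Set.univ to NNReal using ha with A
    lift b to NNReal using (hb.trans ENNReal.coe_lt_top).ne with B
    have hAB : (B : ℝ) < A := by exact_mod_cast hb
    have hpos : (0 : ℝ) < ((1 + A) * (B + 1)) := by positivity
    have hε : 0 < ((A : ℝ) - B) / ((1 + A) * (B + 1)) := div_pos (by linarith) hpos
    refine ⟨_, hε, ?_⟩
    set e := ((A : ℝ) - B) / ((1 + A) * (B + 1)) with he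
    have h1 : e * ((1 + A) * (B + 1)) = A - B := div_mul_cancel₀ _ hpos.ne'
    have h2 : (1 + e + e * A) * B < (A : ℝ) := by
      nlinarith [mul_pos hε (show (0 : ℝ) < 1 + A by positivity)]
    lift e to NNReal using hε.le with e'
    rw [ENNReal.ofReal_coe_nnreal]
    exact_mod_cast h2
  -- the average of `f₀` over translates by `H`
  have hF : Continuous fun s : G => ∫ h : H, f₀ (h * s) ∂α := by
    have hc : Continuous (fun s : G => fun h : H => f₀ (h * s)).uncurry :=
      f₀.continuous'.comp (by fun_prop)
    simpa using continuous_parametric_integral_of_continuous (μ := α) hc isCompact_univ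
  have hlF : ∀ s, ENNReal.ofReal (∫ h : H, f₀ (h * s) ∂α) =
      ∫⁻ h : H, ENNReal.ofReal (f₀ (h * s)) ∂α := by
    intro s
    refine ofReal_integral_eq_lintegral_ofReal ?_ (.of_forall fun h => f₀.nonneg' _)
    have hc : Continuous fun h : H => f₀ (h * s) := f₀.continuous'.comp (by fun_prop)
    exact hc.integrable_of_hasCompactSupport (HasCompactSupport.of_compactSpace _)
  have hone : ∀ (K : Subgroup G) [IsClosed (K : Set G)],
      ∫⁻ t : K, ENNReal.ofReal (f₀ t) ∂(subgroupHaar f₀ K) = 1 := by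
    intro K hK
    have hc : Continuous (fun t : K => f₀ t) := f₀.continuous'.comp continuous_subtype_val
    rw [← ofReal_integral_eq_lintegral_ofReal (hc.integrable_of_hasCompactSupport
      (f₀.hasCompactSupport'.comp_isClosedEmbedding hK.isClosedEmbedding_subtypeVal))
      (.of_forall fun t => f₀.nonneg' _), integral_subgroupHaar, ENNReal.ofReal_one]
  have hFH : ∀ s ∈ H, ∫ h : H, f₀ (h * s) ∂α = 1 := by
    intro s hs
    have h1 := hlF s
    have h2 := lintegral_mul_right_eq_self_of_compactSpace α
      (fun t : H => ENNReal.ofReal (f₀ t)) ⟨s, hs⟩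
    simp only [Subgroup.coe_mul] at h2
    rw [h2, hone] at h1
    simpa using h1
  set D' : Set G := D ∩ {s | ∫ h : H, f₀ (h * s) ∂α < 1 + ε} with hD'
  have hD'o : IsOpen D' := hD.inter (isOpen_lt hF continuous_const)
  have hHD' : (H : Set G) ⊆ D' := fun s hs => ⟨hHD hs, by
    rw [Set.mem_ofPred_eq, hFH s hs]; linarith⟩
  obtain ⟨N₁, hN₁, hN₁f⟩ := exists_nhds_one_abs_sub_lt f₀.continuous' f₀.hasCompactSupport' hε
  obtain ⟨N₂, hN₂c, hN₂⟩ := exists_compact_mem_nhds (1 : G)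
  -- `Q` contains every `s` with `f₀ (h' * s) ≠ 0` for some `h' ∈ N₂ * H`. Since `Q \ D'` is compact
  -- and misses `H`, eventually `H' i ∩ Q ⊆ D'`.
  set Q : Set G := (N₂ * (H : Set G))⁻¹ * tsupport f₀ with hQ
  have hQc : IsCompact Q := (hN₂c.mul hcpt).inv.mul f₀.hasCompactSupport'
  filter_upwards [hmiss (Q \ D') (hQc.diff hD'o)
    (Set.disjoint_left.2 fun s hs hs' => hs.2 (hHD' hs')),
    eventually_forall_exists_mul_inv_mem hcpt hmeet (inter_mem hN₁ hN₂)] with i hi1 hi2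
  have hloc := locallyCompactSpace_of_isClosed (H' i)
  have hscH : SecondCountableTopology H :=
    TopologicalSpace.Subtype.secondCountableTopology (H : Set G)
  have hsc : SecondCountableTopology (H' i) :=
    TopologicalSpace.Subtype.secondCountableTopology (H' i : Set G)
  set β := subgroupHaar f₀ (H' i) with hβ
  set E : Set (H' i) := Subtype.val ⁻¹' D' with hE
  have hEm : MeasurableSet E := (hD'o.preimage continuous_subtype_val).measurableSet
  -- Replace `h` by a nearby `h' ∈ H' i`: left invariance of `β` makes the integral of `f₀ (h' * s)`
  -- equal to `1`, its integrand vanishes off `E`, and it exceeds `f₀ (h * s)` by less than `ε`.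
  -- Averaging over `h` and swapping the integrals then bounds `β E` from below.
  have key : ∀ h : H, 1 ≤ ∫⁻ s in E, (ENNReal.ofReal (f₀ (h * s)) + ENNReal.ofReal ε) ∂β := by
    intro h
    obtain ⟨h', hh', hN⟩ := hi2 h h.2
    rw [← hone (H' i), ← lintegral_mul_left_eq_self _ (⟨h', hh'⟩ : H' i),
      ← lintegral_indicator hEm]
    refine lintegral_mono fun s => ?_
    by_cases hs : s ∈ E
    · rw [Set.indicator_of_mem hs, ← ENNReal.ofReal_add (f₀.nonneg' _) hε.le]
      refine ENNReal.ofReal_le_ofReal ?_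
      have := hN₁f _ hN.1 (h * s)
      simp only [mul_assoc, inv_mul_cancel_left] at this
      have := (abs_lt.1 this).2
      simp only [Subgroup.coe_mul]
      linarith
    · rw [Set.indicator_of_notMem hs, nonpos_iff_eq_zero, ENNReal.ofReal_eq_zero]
      refine le_of_eq ?_
      by_contra hne
      refine Set.disjoint_left.1 hi1 ⟨?_, hs⟩ s.2
      refine ⟨h'⁻¹, Set.inv_mem_inv.2 ⟨h' * (h : G)⁻¹, hN.2, h, h.2, by simp⟩, h' * s,
        subset_tsupport _ hne, by simp⟩
  have hDE : β E ≤ β (Subtype.val ⁻¹' D) := measure_mono fun s hs => hs.1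
  refine lt_of_lt_of_le ?_ hDE
  by_contra hlt
  rw [not_lt] at hlt
  refine hεb.not_ge ?_
  have hm : Measurable fun p : H × H' i => ENNReal.ofReal (f₀ (p.1 * p.2)) + ENNReal.ofReal ε := by
    have : Continuous fun p : H × H' i => f₀ (p.1 * p.2) := f₀.continuous'.comp (by fun_prop)
    exact this.measurable.ennreal_ofReal.add_const _
  calc α Set.univ = ∫⁻ _ : H, 1 ∂α := by simp
    _ ≤ ∫⁻ h : H, ∫⁻ s in E, (ENNReal.ofReal (f₀ (h * s)) + ENNReal.ofReal ε) ∂β ∂α :=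
        lintegral_mono key
    _ = ∫⁻ s in E, ∫⁻ h : H, (ENNReal.ofReal (f₀ (h * s)) + ENNReal.ofReal ε) ∂α ∂β :=
        lintegral_lintegral_swap hm.aemeasurable
    _ ≤ ∫⁻ s in E, (1 + ENNReal.ofReal ε + ENNReal.ofReal ε * α Set.univ) ∂β := by
        refine setLIntegral_mono measurable_const fun s hs => ?_
        rw [lintegral_add_right _ measurable_const, lintegral_const, ← hlF]
        gcongr
        rw [← ENNReal.ofReal_one, ← ENNReal.ofReal_add zero_le_one hε.le]
        exact ENNReal.ofReal_le_ofReal (le_of_lt hs.2)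
    _ = (1 + ENNReal.ofReal ε + ENNReal.ofReal ε * α Set.univ) * β E := by simp
    _ ≤ _ := by gcongr

end Haar

/-! ### Weil's formula and semicontinuity of the quotient measures -/

section Weil

/-- Translates between the right-invariant `ν` and the left-invariant `ν.inv`, for which Weil's
formula is stated. -/
theorem inv_quotientMk_image {G : Type*} [Group G] {H : Subgroup G} [H.Normal] (A : Set G) :
    ((QuotientGroup.mk : G → G ⧸ H) '' A)⁻¹ = QuotientGroup.mk '' A⁻¹ :=
  (Set.image_inv (QuotientGroup.mk' H) A).symm

variable {G : Type*} [Group G] [TopologicalSpace G] [IsTopologicalGroup G] [MeasurableSpace G]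
  [BorelSpace G]

theorem ofReal_cosetIntegral_mk {H : Subgroup G} [H.Normal] [hH : IsClosed (H : Set G)]
    (α : Measure H) [α.IsHaarMeasure] {f : G → ℝ} (hf : Continuous f) (hc : HasCompactSupport f)
    (h0 : ∀ s, 0 ≤ f s) (s : G) :
    ENNReal.ofReal (cosetIntegral α f (QuotientGroup.mk s : G ⧸ H)) =
      ∫⁻ t : H, ENNReal.ofReal (f (s * t)) ∂α := by
  rw [cosetIntegral_mk]
  refine ofReal_integral_eq_lintegral_ofReal ?_ (.of_forall fun t => h0 _)
  have hcont : Continuous fun t : H => f (s * t) := hf.comp (by fun_prop)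
  exact hcont.integrable_of_hasCompactSupport
    ((hc.comp_homeomorph (Homeomorph.mulLeft s)).comp_isClosedEmbedding
      hH.isClosedEmbedding_subtypeVal)

variable [LocallyCompactSpace G]

theorem exists_compactlySupported_eq_cosetIntegral {H : Subgroup G} [H.Normal]
    [hH : IsClosed (H : Set G)] (α : Measure H) [α.IsHaarMeasure] {f : G → ℝ}
    (hf : Continuous f) (hc : HasCompactSupport f) :
    ∃ F : CompactlySupportedContinuousMap (G ⧸ H) ℝ, ∀ q, F q = cosetIntegral α f q := by
  have S := TopologicalGroup.IsSES.ofClosedSubgroup H hH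
  refine ⟨S.pushforward α ⟨⟨f, hf⟩, hc⟩, fun q => ?_⟩
  obtain ⟨s, rfl⟩ := QuotientGroup.mk_surjective q
  rw [cosetIntegral_mk]
  exact S.pushforward_apply_apply α _ s

variable [T2Space G] [SecondCountableTopology G]

theorem IsQuotientMeasure.lintegral_cosetIntegral {μ : Measure G} {H : Subgroup G} [H.Normal]
    [hH : IsClosed (H : Set G)] {α : Measure H} [α.IsHaarMeasure] {ν : Measure (G ⧸ H)}
    (h : IsQuotientMeasure μ α ν) {f : G → ℝ} (hf : Continuous f) (hc : HasCompactSupport f)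
    (h0 : ∀ s, 0 ≤ f s) :
    ∫⁻ q, ENNReal.ofReal (cosetIntegral α f q) ∂ν.inv = ENNReal.ofReal (∫ s, f s ∂μ) := by
  have := h.finiteOnCompacts
  obtain ⟨F, hF⟩ := exists_compactlySupported_eq_cosetIntegral α hf hc
  rw [h.weil f hf hc]
  simp only [← hF]
  refine (ofReal_integral_eq_lintegral_ofReal F.integrable (.of_forall fun q => ?_)).symm
  rw [hF]
  exact integral_nonneg fun t => h0 _

/-- The integral of `f` along a coset is at most the total mass of `α`, and is zero for cosets
outside `O`. -/
theorem IsQuotientMeasure.ofReal_integral_le {μ : Measure G} {H : Subgroup G} [H.Normal]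
    [hH : IsClosed (H : Set G)] {α : Measure H} [α.IsHaarMeasure] {ν : Measure (G ⧸ H)}
    (h : IsQuotientMeasure μ α ν) {f : G → ℝ} (hf : Continuous f) (hc : HasCompactSupport f)
    (h0 : ∀ s, 0 ≤ f s) (h1 : ∀ s, f s ≤ 1) {O : Set (G ⧸ H)} (hO : MeasurableSet O)
    (hfO : ∀ s : G, (s : G ⧸ H) ∉ O → f s = 0) :
    ENNReal.ofReal (∫ s, f s ∂μ) ≤ α Set.univ * ν.inv O := by
  rw [← h.lintegral_cosetIntegral hf hc h0, ← lintegral_indicator_const hO]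
  refine lintegral_mono fun q => ?_
  obtain ⟨s, rfl⟩ := QuotientGroup.mk_surjective q
  rw [ofReal_cosetIntegral_mk α hf hc h0]
  by_cases hs : (s : G ⧸ H) ∈ O
  · rw [Set.indicator_of_mem hs]
    refine (lintegral_mono (g := fun _ => 1) fun t => ?_).trans (by simp)
    exact ENNReal.ofReal_le_one.2 (h1 _)
  · have : ∀ t : H, f (s * t) = 0 := fun t => hfO _ <| by
      rwa [QuotientGroup.mk_mul_of_mem s t.2]
    simp [this]

/-- For `s ∈ U`, the integral of `f` along the coset of `s` is at least the `α`-mass of `D`. -/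
theorem IsQuotientMeasure.mul_le_ofReal_integral {μ : Measure G} {H : Subgroup G} [H.Normal]
    [hH : IsClosed (H : Set G)] {α : Measure H} [α.IsHaarMeasure] {ν : Measure (G ⧸ H)}
    (h : IsQuotientMeasure μ α ν) {f : G → ℝ} (hf : Continuous f) (hc : HasCompactSupport f)
    (h0 : ∀ s, 0 ≤ f s) {D U : Set G} (hD : IsOpen D) (hU : IsOpen U)
    (hfDU : ∀ s ∈ U, ∀ t ∈ D, f (s * t) = 1) :
    α (Subtype.val ⁻¹' D) * ν.inv ((QuotientGroup.mk : G → G ⧸ H) '' U) ≤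
      ENNReal.ofReal (∫ s, f s ∂μ) := by
  rw [← h.lintegral_cosetIntegral hf hc h0, ← lintegral_indicator_const
    (QuotientGroup.isOpenMap_coe U hU).measurableSet]
  refine lintegral_mono fun q => ?_
  by_cases hq : q ∈ (QuotientGroup.mk : G → G ⧸ H) '' U
  · rw [Set.indicator_of_mem hq]
    obtain ⟨s, hs, rfl⟩ := hq
    rw [ofReal_cosetIntegral_mk α hf hc h0, ← lintegral_indicator_one
      (hD.preimage continuous_subtype_val).measurableSet]
    refine lintegral_mono fun t => ?_
    by_cases ht : (t : G) ∈ D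
    · rw [Set.indicator_of_mem (by exact ht), hfDU s hs t ht]
      simp
    · rw [Set.indicator_of_notMem (by exact ht)]
      exact zero_le
  · rw [Set.indicator_of_notMem hq]
    exact zero_le

/-- Upper semicontinuity, on compact sets, of the measures on the quotients by closed normal
subgroups that converge to a compact subgroup. -/
theorem exists_isOpen_eventually_quotientHaar_image_le (μ : Measure G) [μ.IsHaarMeasure]
    (f₀ : Normalizer G) {ι : Type*} {l : Filter ι}
    (H' : ι → Subgroup G) [hH' : ∀ i, IsClosed (H' i : Set G)] [∀ i, (H' i).Normal]
    (H : Subgroup G) [hH : IsClosed (H : Set G)] [H.Normal] (hcpt : IsCompact (H : Set G))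
    (hmiss : ∀ C : Set G, IsCompact C → Disjoint C H → ∀ᶠ i in l, Disjoint C (H' i))
    (hmeet : ∀ A : Set G, IsOpen A → ((H : Set G) ∩ A).Nonempty →
      ∀ᶠ i in l, ((H' i : Set G) ∩ A).Nonempty)
    {C : Set G} (hC : IsCompact C) {c : ℝ≥0∞}
    (hc : quotientHaar μ f₀ H (QuotientGroup.mk '' C) < c) :
    ∃ V : Set G, IsOpen V ∧ C ⊆ V ∧
      ∀ᶠ i in l, quotientHaar μ f₀ (H' i) (QuotientGroup.mk '' V) ≤ c := by
  rcases eq_or_ne c ∞ with rfl | hctop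
  · exact ⟨Set.univ, isOpen_univ, Set.subset_univ _, .of_forall fun _ => le_top⟩
  have hcompH : CompactSpace H := isCompact_iff_compactSpace.1 hcpt
  have hν := isQuotientMeasure_quotientHaar μ f₀ H
  set ν := quotientHaar μ f₀ H with hνdef
  set α := subgroupHaar f₀ H with hα
  have := hν.rightInvariant
  have := hν.finiteOnCompacts
  have hCi : ν.inv (QuotientGroup.mk '' C⁻¹) < c := by
    rwa [← inv_quotientMk_image, Measure.inv_apply, inv_inv]
  obtain ⟨O, hCO, hO, hOc⟩ := Set.exists_isOpen_lt_of_lt _ _ hCi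
  have hsub : C⁻¹ * (H : Set G) ⊆ (QuotientGroup.mk : G → G ⧸ H) ⁻¹' O := by
    rintro _ ⟨s, hs, t, ht, rfl⟩
    refine hCO ⟨s, hs, ?_⟩
    exact (QuotientGroup.mk_mul_of_mem s ht).symm
  have hOo : IsOpen ((QuotientGroup.mk : G → G ⧸ H) ⁻¹' O) :=
    hO.preimage QuotientGroup.continuous_mk
  obtain ⟨L, hL, hCL, hLO⟩ := exists_compact_between (hC.inv.mul hcpt) hOo hsub
  obtain ⟨f, hf1, hf0, hfc, hf01⟩ := exists_continuous_one_zero_of_isCompact hL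
    hOo.isClosed_compl (Set.disjoint_compl_right_iff_subset.2 hLO)
  obtain ⟨U, D, hU, hD, hCU, hHD, hUD⟩ := generalized_tube_lemma hC.inv hcpt
    (isOpen_interior.preimage continuous_mul : IsOpen ((fun p : G × G => p.1 * p.2) ⁻¹' interior L))
    (fun p hp => hCL (Set.mul_mem_mul hp.1 hp.2))
  refine ⟨U⁻¹, hU.inv, fun s hs => hCU (Set.inv_mem_inv.2 hs), ?_⟩
  have ha0 : α Set.univ ≠ 0 := Measure.measure_univ_ne_zero.2 (NeZero.ne α)
  have ha : α Set.univ ≠ ∞ := measure_ne_top _ _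
  have hc0 : c ≠ 0 := (bot_le.trans_lt hc).ne'
  -- The same `f` serves for all `i`: once `H' i` gives `D` mass above `b`, the image of `U` has
  -- `ν.inv`-mass at most `(∫ f) / b`, while `∫ f ≤ α(H) * ν.inv O < b * c`.
  obtain ⟨b, hb1, hb2⟩ : ∃ b, α Set.univ * ν.inv O / c < b ∧ b < α Set.univ := by
    refine exists_between ?_
    rw [ENNReal.div_lt_iff (.inl hc0) (.inl hctop)]
    exact ENNReal.mul_lt_mul_right ha0 ha hOc
  have hb0 : b ≠ 0 := (bot_le.trans_lt hb1).ne'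
  filter_upwards [eventually_lt_subgroupHaar f₀ H' H hcpt hmiss hmeet hD hHD hb2] with i hi
  have hνi := isQuotientMeasure_quotientHaar μ f₀ (H' i)
  have h1 := hνi.mul_le_ofReal_integral f.continuous hfc (fun s => (hf01 s).1) hD hU
    (fun s hs t ht => hf1 (interior_subset (hUD (Set.mk_mem_prod hs ht))))
  have h2 := hν.ofReal_integral_le f.continuous hfc (fun s => (hf01 s).1) (fun s => (hf01 s).2)
    hO.measurableSet (fun s hs => hf0 hs)
  rw [← inv_quotientMk_image, ← Measure.inv_apply]
  rw [ENNReal.div_lt_iff (.inl hc0) (.inl hctop)] at hb1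
  have h3 : b * (quotientHaar μ f₀ (H' i)).inv (QuotientGroup.mk '' U) ≤ b * c :=
    (mul_le_mul_left hi.le _).trans (h1.trans (h2.trans hb1.le))
  exact (ENNReal.mul_le_mul_iff_right hb0 (hb2.trans_le le_top).ne).1 h3

end Weil

/-! ### Greedy selection and diagonalization -/

theorem exists_fin_pairwise_of_finset_extension {α : Type*} {P : α → Prop} {R : α → α → Prop}
    (k : ℕ) (h : ∀ s : Finset α, s.card < k → (∀ u ∈ s, P u) → ∃ t, P t ∧ ∀ u ∈ s, R u t) :
    ∃ t : Fin k → α, (∀ i, P (t i)) ∧ ∀ i j, i < j → R (t i) (t j) := by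
  classical
  induction k with
  | zero => exact ⟨Fin.elim0, fun i => i.elim0, fun i => i.elim0⟩
  | succ k ih =>
    obtain ⟨t, ht, hR⟩ := ih fun s hs => h s (hs.trans k.lt_succ_self)
    obtain ⟨a, ha, haR⟩ := h (Finset.univ.image t)
      (Nat.lt_succ_of_le (Finset.card_image_le.trans (by simp))) (by simpa using ht)
    refine ⟨Fin.snoc t a, fun i => ?_, fun i j hij => ?_⟩
    · refine Fin.lastCases (by simpa using ha) (fun i => by simpa using ht i) i
    · induction j using Fin.lastCases with
      | last =>
        induction i using Fin.lastCases with
        | last => exact absurd hij (lt_irrefl _)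
        | cast i => simpa using haR (t i) (by simp)
      | cast j =>
        induction i using Fin.lastCases with
        | last => exact absurd hij (not_lt.2 (Fin.le_last _))
        | cast i => simpa using hR i j (by simpa using hij)

/-- Take for `φ n` the largest `m ≤ n` with `P m n`; eventually one exists because `P 0 n` holds. -/
theorem exists_tendsto_atTop_eventually {P : ℕ → ℕ → Prop}
    (h : ∀ m, ∀ᶠ n in atTop, P m n) :
    ∃ φ : ℕ → ℕ, Tendsto φ atTop atTop ∧ ∀ᶠ n in atTop, P (φ n) n := by
  classical
  refine ⟨fun n => Nat.findGreatest (fun m => P m n) n, ?_, ?_⟩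
  · refine tendsto_atTop.2 fun M => ?_
    filter_upwards [h M, eventually_ge_atTop M] with n h1 h2
    exact Nat.le_findGreatest h2 h1
  · filter_upwards [h 0] with n hn
    exact Nat.findGreatest_spec (P := fun m => P m n) (Nat.zero_le n) hn

/-! ### Convergence in the Fell topology -/

section Fell

variable {G : Type*} [Group G] [TopologicalSpace G]

theorem eventually_disjoint_of_tendsto_closedSubgroup {ι : Type*} {l : Filter ι}
    {H' : ι → ClosedSubgroup G} {H : ClosedSubgroup G} (h : Tendsto H' l (𝓝 H)) {C : Set G}
    (hC : IsCompact C) (hCH : Disjoint C (H : Set G)) :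
    ∀ᶠ i in l, Disjoint C (H' i : Set G) := by
  have ho : IsOpen (fellBasic C ∅) := TopologicalSpace.isOpen_generateFrom_of_mem
    ⟨C, ∅, hC, Set.finite_empty, by simp, rfl⟩
  filter_upwards [h.eventually (ho.mem_nhds ⟨hCH.inter_eq, by simp⟩)] with i hi
  exact Set.disjoint_iff_inter_eq_empty.2 hi.1

theorem eventually_nonempty_inter_of_tendsto_closedSubgroup {ι : Type*} {l : Filter ι}
    {H' : ι → ClosedSubgroup G} {H : ClosedSubgroup G} (h : Tendsto H' l (𝓝 H)) {A : Set G}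
    (hA : IsOpen A) (hHA : ((H : Set G) ∩ A).Nonempty) :
    ∀ᶠ i in l, ((H' i : Set G) ∩ A).Nonempty := by
  have ho : IsOpen (fellBasic ∅ {A}) := TopologicalSpace.isOpen_generateFrom_of_mem
    ⟨∅, {A}, isCompact_empty, Set.finite_singleton A, by
      simpa using ⟨hA, hHA.mono Set.inter_subset_right⟩, rfl⟩
  filter_upwards [h.eventually (ho.mem_nhds ⟨by simp, by simpa using hHA⟩)] with i hi
  exact hi.2 A rfl

end Fell

/-! ### Separated points on orbits -/

section Action

/-- Normality moves the stabilizer past `s`: if `κ = t * s⁻¹ * u` with `u` in the stabilizer, then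
`κ * s` lies in the coset of `t`. -/
theorem exists_mul_eq_of_not_disjoint {G X : Type*} [Group G] [MulAction G X] {x : X} [(MulAction.stabilizer G x).Normal] {s t : G}
    {K : Set G} (h : ¬ Disjoint ((t * s⁻¹) • (MulAction.stabilizer G x : Set G)) K) :
    ∃ κ ∈ K, (κ * s) • x = t • x ∧
      (κ * s : G ⧸ MulAction.stabilizer G x) = (t : G ⧸ MulAction.stabilizer G x) := by
  obtain ⟨κ, ⟨u, hu, rfl⟩, hκ⟩ := Set.not_disjoint_iff.1 h
  have hu' : s⁻¹ * u * s ∈ MulAction.stabilizer G x := by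
    simpa using Subgroup.Normal.conj_mem inferInstance u hu s⁻¹
  have he : t * s⁻¹ * u * s = t * (s⁻¹ * u * s) := by group
  refine ⟨_, hκ, ?_, ?_⟩
  · simp only [smul_eq_mul]
    rw [he, mul_smul, MulAction.mem_stabilizer_iff.1 hu']
  · simp only [smul_eq_mul]
    rw [← QuotientGroup.mk_mul, he, QuotientGroup.mk_mul_of_mem _ hu']

variable {G X : Type*} [Group G] [TopologicalSpace G] [TopologicalSpace X] [MulAction G X]

variable [T2Space X] [ContinuousSMul G X]

/-- Translates with limits in different `K`-translates are eventually `K`-separated. -/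
theorem eventually_disjoint_of_tendsto {ι : Type*} {l : Ultrafilter ι} {x : ι → X}
    [∀ i, (MulAction.stabilizer G (x i)).Normal] {s t : ι → G} {u v : X}
    (hs : Tendsto (fun i => s i • x i) l (𝓝 u)) (ht : Tendsto (fun i => t i • x i) l (𝓝 v))
    {K : Set G} (hK : IsCompact K) (hv : v ∉ (fun κ : G => κ • u) '' K) :
    ∀ᶠ i in (l : Filter ι),
      Disjoint ((t i * (s i)⁻¹) • (MulAction.stabilizer G (x i) : Set G)) K := by
  by_contra hcon
  rw [← Ultrafilter.eventually_not] at hcon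
  obtain ⟨κ, hκ⟩ := (hcon.mono fun i hi => exists_mul_eq_of_not_disjoint hi).choice
  obtain ⟨κ₀, hκ₀, hlim⟩ := hK.ultrafilter_le_nhds (l.map κ)
    (le_principal_iff.2 (hκ.mono fun i hi => hi.1))
  have hlim' : Tendsto κ l (𝓝 κ₀) := hlim
  refine hv ⟨κ₀, hκ₀, tendsto_nhds_unique (hlim'.smul hs) (ht.congr' ?_)⟩
  filter_upwards [hκ] with i hi
  rw [← hi.2.1, mul_smul]

/-- If the limit orbits other than the orbit of `z` accumulate at `z`, then the orbits return to
every neighbourhood of `z` arbitrarily often. -/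
theorem eventually_exists_separated_of_accumulation {ι : Type*} {l : Ultrafilter ι} {x : ι → X}
    [∀ i, (MulAction.stabilizer G (x i)).Normal] {z : X}
    (hacc : ∀ V ∈ 𝓝 z, ∃ y ∈ V, y ∉ MulAction.orbit G z ∧
      ∃ t : ι → G, Tendsto (fun i => t i • x i) l (𝓝 y))
    (k : ℕ) {V : Set X} (hV : V ∈ 𝓝 z) {K : Set G} (hK : IsCompact K) :
    ∀ᶠ i in (l : Filter ι), ∃ t : Fin k → G, (∀ a, t a • x i ∈ V) ∧
      ∀ a b, a < b → Disjoint ((t b * (t a)⁻¹) • (MulAction.stabilizer G (x i) : Set G)) K := by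
  obtain ⟨y, hy, hsep⟩ := exists_fin_pairwise_of_finset_extension
    (P := fun y => y ∈ interior V ∧ y ∉ MulAction.orbit G z ∧
      ∃ t : ι → G, Tendsto (fun i => t i • x i) l (𝓝 y))
    (R := fun u v => v ∉ (fun κ : G => κ • u) '' K) k fun s _ hs => by
      -- The chosen `u` lie off the orbit of `z`, so the compact sets `K • u` avoid `z` and a
      -- neighbourhood of `z` avoids them all.
      have hO : interior V ∩ ⋂ u ∈ s, ((fun κ : G => κ • u) '' K)ᶜ ∈ 𝓝 z := by
        refine inter_mem (interior_mem_nhds.2 hV) ((biInter_finset_mem s).2 fun u hu => ?_)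
        have hc : Continuous fun κ : G => κ • u := by fun_prop
        refine (hK.image hc).isClosed.isOpen_compl.mem_nhds ?_
        rintro ⟨κ, -, rfl⟩
        exact (hs u hu).2.1 (MulAction.mem_orbit_symm.1 (MulAction.mem_orbit u κ))
      obtain ⟨y, hy, hyz, hyt⟩ := hacc _ hO
      exact ⟨y, ⟨hy.1, hyz, hyt⟩, fun u hu => Set.mem_iInter₂.1 hy.2 u hu⟩
  choose hyV hyz t ht using hy
  have h1 : ∀ᶠ i in (l : Filter ι), ∀ a, t a i • x i ∈ V := eventually_all.2 fun a =>
    (ht a).eventually (mem_interior_iff_mem_nhds.1 (hyV a))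
  have h2 : ∀ᶠ i in (l : Filter ι), ∀ a b, a < b →
      Disjoint ((t b i * (t a i)⁻¹) • (MulAction.stabilizer G (x i) : Set G)) K :=
    eventually_all.2 fun a => eventually_all.2 fun b => eventually_imp_distrib_left.2 fun hab =>
      eventually_disjoint_of_tendsto (ht a) (ht b) hK (hsep a b hab)
  filter_upwards [h1, h2] with i hi1 hi2
  exact ⟨fun a => t a i, hi1, hi2⟩

variable [IsTopologicalGroup G] [LocallyCompactSpace G] [T2Space G] [SecondCountableTopology G]
  [MeasurableSpace G] [BorelSpace G]

/-- Right translation by `g` changes the base point from `g • z` to `z` and preserves the measure.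
-/
theorem quotientHaar_image_le_orbitMass (μ : Measure G) [μ.IsHaarMeasure] (f₀ : Normalizer G)
    {z : X} [(MulAction.stabilizer G z).Normal] (g : G) {W : Set X} {C : Set G}
    (hC : ∀ s ∈ C, s • g • z ∈ W) :
    quotientHaar μ f₀ (MulAction.stabilizer G z) (QuotientGroup.mk '' C) ≤
      orbitMass μ f₀ z W := by
  have := (isQuotientMeasure_quotientHaar μ f₀ (MulAction.stabilizer G z)).rightInvariant
  rw [orbitMass, ← measure_preimage_mul_right _ (g : G ⧸ MulAction.stabilizer G z)
    (QuotientGroup.mk '' ((fun s : G => s • z) ⁻¹' W))]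
  refine measure_mono ?_
  rintro _ ⟨s, hs, rfl⟩
  exact ⟨s * g, by simpa [mul_smul] using hC s hs, rfl⟩

/-- If all limits in the compact set `W` of points of the orbits lie in the orbit of `z`, then the
mass that an orbit has in `W`, seen through a compact set of translations from any of its points
in `W`, is eventually bounded by the mass of the orbit of `z`. -/
theorem eventually_quotientHaar_image_le (μ : Measure G) [μ.IsHaarMeasure] (f₀ : Normalizer G)
    {ι : Type*} {l : Ultrafilter ι} {x : ι → X} {z : X}
    [(MulAction.stabilizer G z).Normal] [∀ i, (MulAction.stabilizer G (x i)).Normal]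
    (hcpt : IsCompact (MulAction.stabilizer G z : Set G))
    (hstab : Tendsto (fun i => closedStabilizer G (x i)) l (𝓝 (closedStabilizer G z)))
    {W : Set X} (hW : IsCompact W)
    (hlim : ∀ y ∈ W, ∀ t : ι → G, Tendsto (fun i => t i • x i) l (𝓝 y) →
      y ∈ MulAction.orbit G z)
    {K : Set G} (hK : IsCompact K) {c : ℝ≥0∞} (hc : orbitMass μ f₀ z W < c) :
    ∀ᶠ i in (l : Filter ι), ∀ t : G, t • x i ∈ W →
      quotientHaar μ f₀ (MulAction.stabilizer G (x i))
        (QuotientGroup.mk '' {s ∈ K | (s * t) • x i ∈ W}) ≤ c := by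
  by_contra hcon
  rw [← Ultrafilter.eventually_not] at hcon
  push Not at hcon
  obtain ⟨t, ht⟩ := hcon.choice
  obtain ⟨y, hyW, hy⟩ := hW.ultrafilter_le_nhds (l.map fun i => t i • x i)
    (le_principal_iff.2 (ht.mono fun i hi => hi.1))
  have hy' : Tendsto (fun i => t i • x i) l (𝓝 y) := hy
  obtain ⟨g, rfl⟩ := hlim y hyW t hy'
  have hCc : IsCompact {s ∈ K | s • g • z ∈ W} :=
    hK.inter_right (hW.isClosed.preimage (by fun_prop : Continuous fun s : G => s • g • z))
  obtain ⟨V, hV, hCV, hle⟩ := exists_isOpen_eventually_quotientHaar_image_le μ f₀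
    (fun i => MulAction.stabilizer G (x i)) (MulAction.stabilizer G z) hcpt
    (fun C hC hCH => eventually_disjoint_of_tendsto_closedSubgroup hstab hC hCH)
    (fun A hA hHA => eventually_nonempty_inter_of_tendsto_closedSubgroup hstab hA hHA)
    hCc ((quotientHaar_image_le_orbitMass μ f₀ g (W := W) fun s hs => hs.2).trans_lt hc)
  -- The image of `V` has mass at most `c`, so excess mass forces returns to `W` through `K \ V`. A
  -- limit `s₀` of these translations would satisfy `s₀ • g • z ∈ W`, hence lie in `V`.
  have hbad : ∀ᶠ i in (l : Filter ι), ∃ s ∈ K \ V, (s * t i) • x i ∈ W := by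
    filter_upwards [ht, hle] with i hi1 hi2
    by_contra! hno
    refine (hi1.2.trans_le ((measure_mono (Set.image_mono fun s hs => ?_)).trans hi2)).false
    by_contra hsV
    exact hno s ⟨hs.1, hsV⟩ hs.2
  obtain ⟨s, hs⟩ := hbad.choice
  obtain ⟨s₀, hs₀, hlim₀⟩ := (hK.diff hV).ultrafilter_le_nhds (l.map s)
    (le_principal_iff.2 (hs.mono fun i hi => hi.1))
  have hlim' : Tendsto s l (𝓝 s₀) := hlim₀
  refine hs₀.2 (hCV ⟨hs₀.1, hW.isClosed.mem_of_tendsto (hlim'.smul hy') ?_⟩)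
  filter_upwards [hs] with i hi
  simpa [mul_smul] using hi.2

/-- An orbit of large mass in `W` contains many separated points of `W`, provided that the mass
seen through `K` from each of its points in `W` is small. -/
theorem exists_separated_of_lt_orbitMass (μ : Measure G) [μ.IsHaarMeasure] (f₀ : Normalizer G)
    {x : X} [(MulAction.stabilizer G x).Normal] {W : Set X} {K : Set G} {c : ℝ≥0∞} {k : ℕ}
    (hc : ∀ t : G, t • x ∈ W → quotientHaar μ f₀ (MulAction.stabilizer G x)
        (QuotientGroup.mk '' {s ∈ K | (s * t) • x ∈ W}) ≤ c)
    (hmass : ((k - 1 : ℕ) : ℝ≥0∞) * c < orbitMass μ f₀ x W) :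
    ∃ t : Fin k → G, (∀ a, t a • x ∈ W) ∧
      ∀ a b, a < b → Disjoint ((t b * (t a)⁻¹) • (MulAction.stabilizer G x : Set G)) K := by
  have := (isQuotientMeasure_quotientHaar μ f₀ (MulAction.stabilizer G x)).rightInvariant
  refine exists_fin_pairwise_of_finset_extension (P := fun t : G => t • x ∈ W)
    (R := fun s t => Disjoint ((t * s⁻¹) • (MulAction.stabilizer G x : Set G)) K) k
    fun F hF hFW => ?_
  by_contra! hno
  refine hmass.not_ge ?_
  -- If no further separated point exists, the part of the orbit in `W` is covered by what is seen
  -- through `K` from the points of `F`, at most `k - 1` in number.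
  have hsub : (QuotientGroup.mk : G → G ⧸ MulAction.stabilizer G x) ''
      ((fun s : G => s • x) ⁻¹' W) ⊆ ⋃ u ∈ F, (fun q => q * (u : G ⧸ MulAction.stabilizer G x)⁻¹) ⁻¹'
        (QuotientGroup.mk '' {s ∈ K | (s * u) • x ∈ W}) := by
    rintro _ ⟨t, ht, rfl⟩
    obtain ⟨u, hu, hd⟩ := hno t ht
    obtain ⟨κ, hκ, h1, h2⟩ := exists_mul_eq_of_not_disjoint hd
    refine Set.mem_iUnion₂.2 ⟨u, hu, κ, ⟨hκ, ?_⟩, ?_⟩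
    · rw [h1]; exact ht
    · exact eq_mul_inv_of_mul_eq h2
  calc orbitMass μ f₀ x W ≤ _ := measure_mono hsub
    _ ≤ ∑ u ∈ F, _ := measure_biUnion_finset_le F _
    _ ≤ ∑ u ∈ F, c := Finset.sum_le_sum fun u hu => by
        rw [measure_preimage_mul_right]
        exact hc u (hFW u hu)
    _ = (F.card : ℝ≥0∞) * c := by simp
    _ ≤ _ := by
        gcongr
        omega

end Action

end OrbitConvergence

/-! ### The proposition -/

theorem proposition3p5 {G X : Type*}
    [Group G] [TopologicalSpace G] [IsTopologicalGroup G] [LocallyCompactSpace G] [T2Space G]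
    [SecondCountableTopology G] [MeasurableSpace G] [BorelSpace G]
    [TopologicalSpace X] [LocallyCompactSpace X] [T2Space X] [SecondCountableTopology X]
    [MulAction G X] [ContinuousSMul G X]
    (μ : Measure G) [μ.IsHaarMeasure] (f₀ : OrbitConvergence.Normalizer G)
    (z : X) (x : ℕ → X)
    (hz : IsLocallyClosed (MulAction.orbit G z))
    (hcpt : IsCompact (MulAction.stabilizer G z : Set G))
    (hstab : Tendsto (fun n => OrbitConvergence.closedStabilizer G (x n)) atTop
      (𝓝 (OrbitConvergence.closedStabilizer G z)))
    [(MulAction.stabilizer G z).Normal] [∀ n, (MulAction.stabilizer G (x n)).Normal]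
    (hlim : Tendsto (fun n => (Quotient.mk _ (x n) : MulAction.orbitRel.Quotient G X)) atTop
      (𝓝 (Quotient.mk _ z)))
    (huniq : ∀ y : MulAction.orbitRel.Quotient G X,
      Tendsto (fun n => (Quotient.mk _ (x n) : MulAction.orbitRel.Quotient G X)) atTop (𝓝 y) →
        y = Quotient.mk _ z)
    (k : ℕ) (hk : 1 ≤ k)
    (W : ℕ → Set X) (hWcpt : ∀ m, IsCompact (W m)) (hWnhds : ∀ m, W m ∈ 𝓝 z)
    (hWbasic : ∀ V ∈ 𝓝 z, ∃ m, W m ⊆ V) (hWanti : ∀ m, W (m + 1) ⊆ W m)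
    (hmass : ∀ m, ((k - 1 : ℕ) : ℝ≥0∞) * OrbitConvergence.orbitMass μ f₀ z (W m) <
      liminf (fun n => OrbitConvergence.orbitMass μ f₀ (x n) (W m)) atTop) :
    OrbitConvergence.ConvergesKTimes G k x z := by
  have key : ∀ (m : ℕ) (K : Set G), IsCompact K → ∀ᶠ n in atTop, ∃ t : Fin k → G,
      (∀ a, t a • x n ∈ W m) ∧ ∀ a b, a < b →
        Disjoint ((t b * (t a)⁻¹) • (MulAction.stabilizer G (x n) : Set G)) K := by
    intro m K hK
    refine mem_iff_ultrafilter.2 fun l hl => ?_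
    by_cases hacc : ∀ V ∈ 𝓝 z, ∃ y ∈ V, y ∉ MulAction.orbit G z ∧
        ∃ t : ℕ → G, Tendsto (fun i => t i • x i) l (𝓝 y)
    · exact OrbitConvergence.eventually_exists_separated_of_accumulation hacc k (hWnhds m) hK
    push Not at hacc
    obtain ⟨V, hV, hVz⟩ := hacc
    obtain ⟨m', hm'⟩ := hWbasic _ (inter_mem hV (hWnhds m))
    have hlimit : ∀ y ∈ W m', ∀ t : ℕ → G, Tendsto (fun i => t i • x i) l (𝓝 y) →
        y ∈ MulAction.orbit G z := fun y hy t ht => by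
      by_contra hyz
      exact hVz y (hm' hy).1 hyz t ht
    obtain ⟨c, hc, hcm⟩ : ∃ c : ℝ≥0∞, (∀ᶠ n in (l : Filter ℕ), ∀ t : G, t • x n ∈ W m' →
        OrbitConvergence.quotientHaar μ f₀ (MulAction.stabilizer G (x n))
          (QuotientGroup.mk '' {s ∈ K | (s * t) • x n ∈ W m'}) ≤ c) ∧
        ((k - 1 : ℕ) : ℝ≥0∞) * c <
          liminf (fun n => OrbitConvergence.orbitMass μ f₀ (x n) (W m')) atTop := by
      rcases Nat.eq_zero_or_pos (k - 1) with h0 | hpos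
      -- For `k = 1` the mass of the orbit of `z` may be infinite, leaving no room above it; `c = ∞`
      -- works because `0 * ∞ = 0`.
      · refine ⟨∞, .of_forall fun _ _ _ => le_top, ?_⟩
        have := hmass m'
        rw [h0] at this ⊢
        simpa using this
      · have hne : ((k - 1 : ℕ) : ℝ≥0∞) ≠ 0 := by exact_mod_cast hpos.ne'
        have h := hmass m'
        rw [mul_comm, ← ENNReal.lt_div_iff_mul_lt (.inl hne) (.inl (ENNReal.natCast_ne_top _))] at h
        obtain ⟨c, hc1, hc2⟩ := exists_between h
        rw [ENNReal.lt_div_iff_mul_lt (.inl hne) (.inl (ENNReal.natCast_ne_top _)), mul_comm] at hc2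
        exact ⟨c, OrbitConvergence.eventually_quotientHaar_image_le μ f₀ hcpt (hstab.mono_left hl)
          (hWcpt m') hlimit hK hc1, hc2⟩
    filter_upwards [hc, hl (eventually_lt_of_lt_liminf hcm)] with n hn1 hn2
    obtain ⟨t, ht, hsep⟩ := OrbitConvergence.exists_separated_of_lt_orbitMass μ f₀ hn1 hn2
    exact ⟨t, fun a => (hm' (ht a)).2, hsep⟩
  -- Diagonalize over `W m` and an exhaustion by compact sets at once, so that closeness to `z` and
  -- separation improve together.
  have K : CompactExhaustion G := default
  obtain ⟨φ, hφ, hev⟩ := OrbitConvergence.exists_tendsto_atTop_eventually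
    (P := fun m n => ∃ t : Fin k → G, (∀ a, t a • x n ∈ W m) ∧ ∀ a b, a < b →
      Disjoint ((t b * (t a)⁻¹) • (MulAction.stabilizer G (x n) : Set G)) (K m))
    (fun m => key m _ (K.isCompact m))
  obtain ⟨t, ht⟩ := hev.choice
  have hW : Antitone W := antitone_nat_of_succ_le hWanti
  refine ⟨fun a n => t n a, fun a => ?_, fun a b hab C hC => ?_⟩
  · refine tendsto_def.2 fun V hV => ?_
    obtain ⟨m, hm⟩ := hWbasic V hV
    filter_upwards [ht, hφ.eventually_ge_atTop m] with n hn hmn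
    exact hm (hW hmn (hn.1 a))
  · obtain ⟨m, hm⟩ := K.exists_superset_of_isCompact hC
    filter_upwards [ht, hφ.eventually_ge_atTop m] with n hn hmn
    exact (hn.2 a b hab).mono_right (hm.trans (K.subset hmn))
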